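/- Let $\{S(h): h\in L^2_{\mathbb R}(\mathbb R_+)\}$, $S(h)=l(h)+l(h)^*$, be the semicircular (field) operators on the free Fock space $\mathcal F=\bigoplus_{n\ge 0}L^2_{\mathbb C}(\mathbb R_+)^{\otimes n}$ with vacuum vector $\Omega$, let $\mathcal{SC}$ be the von Neumann algebra they generate, with the trace $\tau(X)=\langle X\Omega,\Omega\rangle$, and let $\mathcal{SC}_{alg}$ be the unital $*$-algebra they generate. Identify $L^2(\mathcal{SC},\tau)$ with $\mathcal F$ through $X\mapsto X\Omega$. Let $\nabla$ be the free Malliavin derivative on $\mathcal{SC}_{alg}$, i.e. the derivation with $\nabla_t S(h)=h(t)\,1\otimes 1$ and $\nabla_t(AB)=(A\otimes 1)\,\nabla_tB+\nabla_tA\,(1\otimes B)$, and for an integer $k\ge 1$ let $$\nabla^k_{t_1,\dots,t_k}=(\mathrm{id}^{\otimes (k-1)}\otimes\nabla_{t_k})\circ\cdots\circ(\mathrm{id}\otimes\nabla_{t_2})\circ\nabla_{t_1}$$ be its iterates, so that $\nabla^k$ maps $\mathcal{SC}_{alg}\subset L^2(\mathcal{SC},\tau)$ into $\mathbb M_2^{k,k+1}=L^2\big(\mathbb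 R_+^k,\,L^2(\mathcal{SC}^{\otimes (k+1)},\tau^{\otimes(k+1)})\big)$. Let $(P_t)_{t\ge0}$ be the free Ornstein–Uhlenbeck semigroup, i.e. $P_t$ is the second quantization of $e^{-t}\,\mathrm{id}$: it acts on $L^2_{\mathbb C}(\mathbb R_+)^{\otimes n}\subset\mathcal F$ as multiplication by $e^{-nt}$; the operator $P_t^{\otimes(k+1)}$ acts on $\mathbb M_2^{k,k+1}$ pointwise in $(t_1,\dots,t_k)$. **Proposition.** Let $k\ge 1$ be an integer. The operator $\nabla^k$ is well defined and closable on $\mathcal{SC}_{alg}$; denote its closure again by $\nabla^k$ and the domain of the closure by $\mathbb D^{k,2}$. For every $F\in\mathbb D^{k,2}$ and every $t>0$ one has $P_tF\in\mathbb D^{k,2}$ and $$\nabla^kP_tF=e^{-kt}\,P_t^{\otimes(k+1)}\,\nabla^kF .$$ In particular, for $k=1$, $\nabla P_tF=e^{-t}P_t^{\otimes 2}\nabla F$ for $F\in\mathbb D^{1,2}$ and $t>0$. -/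

import Mathlib

open MeasureTheory TensorProduct UniformSpace
open scoped ENNReal NNReal

noncomputable section

namespace FreeWigner

/-! ### Hilbert space tensor powers -/

/-- A complex Hilbert space, bundled so that one can recurse on it. -/
structure CHilbert : Type 1 where
  carrier : Type
  [normedAddCommGroup : NormedAddCommGroup carrier]
  [innerProductSpace : InnerProductSpace ℂ carrier]
  [completeSpace : CompleteSpace carrier]

attribute [instance] CHilbert.normedAddCommGroup CHilbert.innerProductSpace CHilbert.completeSpace

section TensorPower

variable (E : Type) [NormedAddCommGroup E] [InnerProductSpace ℂ E]

/-- The tensor powers of `E` as bundled Hilbert spaces: `ℂ` for the exponent `0`, and the completion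
of the algebraic tensor product of `E` with the `n`-th power for the exponent `n + 1`. -/
def tensorPowerAux : ℕ → CHilbert
  | 0 => ⟨ℂ⟩
  | n + 1 => ⟨Completion (E ⊗[ℂ] (tensorPowerAux n).carrier)⟩

/-- The Hilbert space tensor power `E^{⊗n}` (completed). -/
def HPow (n : ℕ) : Type := (tensorPowerAux E n).carrier

instance (n : ℕ) : NormedAddCommGroup (HPow E n) := (tensorPowerAux E n).normedAddCommGroup
instance (n : ℕ) : InnerProductSpace ℂ (HPow E n) := (tensorPowerAux E n).innerProductSpace
instance (n : ℕ) : CompleteSpace (HPow E n) := (tensorPowerAux E n).completeSpace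

/-- `E^{⊗0} = ℂ`. -/
def HPow.zeroEquiv : HPow E 0 ≃ₗᵢ[ℂ] ℂ := LinearIsometryEquiv.refl ℂ ℂ

/-- `E^{⊗(n+1)}` is the completion of `E ⊗ E^{⊗n}`. -/
def HPow.succEquiv (n : ℕ) : HPow E (n + 1) ≃ₗᵢ[ℂ] Completion (E ⊗[ℂ] HPow E n) :=
  LinearIsometryEquiv.refl ℂ (Completion (E ⊗[ℂ] HPow E n))

attribute [irreducible] tensorPowerAux

variable {E}

/-- The elementary tensor `x ⊗ u ∈ E^{⊗(n+1)}` for `x ∈ E` and `u ∈ E^{⊗n}`. -/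
def HPow.cons {n : ℕ} (x : E) (u : HPow E n) : HPow E (n + 1) :=
  (HPow.succEquiv E n).symm ((x ⊗ₜ[ℂ] u : E ⊗[ℂ] HPow E n) : Completion (E ⊗[ℂ] HPow E n))

theorem HPow.norm_cons {n : ℕ} (x : E) (u : HPow E n) : ‖HPow.cons x u‖ = ‖x‖ * ‖u‖ := by
  simp [HPow.cons]

/-- `u ↦ x ⊗ u` as a bounded operator `E^{⊗n} → E^{⊗(n+1)}`. -/
def HPow.consL {n : ℕ} (x : E) : HPow E n →L[ℂ] HPow E (n + 1) :=
  LinearMap.mkContinuous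
    { toFun := fun u => HPow.cons x u
      map_add' := fun u v => by
        simp only [HPow.cons, TensorProduct.tmul_add, Completion.coe_add, map_add]
      map_smul' := fun c u => by
        simp only [HPow.cons, TensorProduct.tmul_smul, Completion.coe_smul, map_smul,
          RingHom.id_apply] }
    ‖x‖ (fun u => (HPow.norm_cons x u).le)

@[simp] theorem HPow.consL_apply {n : ℕ} (x : E) (u : HPow E n) :
    HPow.consL x u = HPow.cons x u := rfl

/-- The tensor power `A^{⊗n}` of a bounded operator `A`. -/
def HPow.map (A : E →L[ℂ] E) : (n : ℕ) → HPow E n →L[ℂ] HPow E n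
  | 0 => ContinuousLinearMap.id ℂ _
  | n + 1 =>
    (HPow.succEquiv E n).symm.toContinuousLinearEquiv.toContinuousLinearMap ∘L
      (TensorProduct.mapL A (HPow.map A n)).completion ∘L
        (HPow.succEquiv E n).toContinuousLinearEquiv.toContinuousLinearMap

theorem HPow.map_cons (A : E →L[ℂ] E) {n : ℕ} (x : E) (u : HPow E n) :
    HPow.map A (n + 1) (HPow.cons x u) = HPow.cons (A x) (HPow.map A n u) := by
  simp [HPow.map, HPow.cons]

theorem HPow.norm_map_apply_le {A : E →L[ℂ] E} (hA : ‖A‖ ≤ 1) (n : ℕ) (u : HPow E n) :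
    ‖HPow.map A n u‖ ≤ ‖u‖ := by
  induction n with
  | zero => exact le_rfl
  | succ n ih =>
    have h1 : ‖HPow.map A n‖ ≤ 1 :=
      ContinuousLinearMap.opNorm_le_bound _ zero_le_one fun v => by simpa using ih v
    have h2 : ‖TensorProduct.mapL A (HPow.map A n)‖ ≤ 1 :=
      (TensorProduct.norm_mapL_le _ _).trans (mul_le_one₀ hA (norm_nonneg _) h1)
    have h3 : ∀ v : Completion (E ⊗[ℂ] HPow E n),
        ‖(TensorProduct.mapL A (HPow.map A n)).completion v‖ ≤ ‖v‖ := by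
      intro v
      induction v using Completion.induction_on with
      | hp => exact isClosed_le (by fun_prop) continuous_norm
      | ih a =>
        simpa using (ContinuousLinearMap.le_of_opNorm_le _ h2 a)
    simpa [HPow.map] using h3 (HPow.succEquiv E n u)

end TensorPower

/-! ### The full Fock space, second quantization, semicircular operators -/

section Fock

variable (E : Type) [NormedAddCommGroup E] [InnerProductSpace ℂ E]

/-- The free (full) Fock space `⨁ₙ E^{⊗n}` (Hilbert space direct sum). -/
abbrev Fock : Type := lp (fun n : ℕ => HPow E n) 2

/-- The vacuum vector `Ω`: the unit `1 ∈ ℂ = E^{⊗0}`. -/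
def vacuum : Fock E := lp.single 2 0 ((HPow.zeroEquiv E).symm 1)

variable {E}

theorem memlp_of_norm_le {u : Fock E} {v : (n : ℕ) → HPow E n} (h : ∀ n, ‖v n‖ ≤ ‖u n‖) :
    Memℓp v 2 := by
  have hu := (lp.memℓp u).summable (by norm_num)
  refine memℓp_gen (Summable.of_nonneg_of_le (fun n => by positivity) (fun n => ?_) hu)
  gcongr
  exact h n

theorem norm_sq_eq_tsum (u : Fock E) : ‖u‖ ^ 2 = ∑' n, ‖u n‖ ^ 2 := by
  simpa using lp.norm_rpow_eq_tsum (p := 2) (by norm_num) u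

theorem summable_norm_sq (u : Fock E) : Summable fun n => ‖u n‖ ^ 2 := by
  simpa using (lp.memℓp u).summable (p := 2) (by norm_num)

/-- Second quantization of a contraction `A`: it acts as `A^{⊗n}` on `E^{⊗n}`. -/
def secondQuantization (A : E →L[ℂ] E) (hA : ‖A‖ ≤ 1) : Fock E →L[ℂ] Fock E :=
  LinearMap.mkContinuous
    { toFun := fun u => ⟨fun n => HPow.map A n (u n),
        memlp_of_norm_le (u := u) fun n => HPow.norm_map_apply_le hA n _⟩
      map_add' := fun u v => by
        ext n
        exact (HPow.map A n).map_add (u n) (v n)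
      map_smul' := fun c u => by
        ext n
        exact (HPow.map A n).map_smul c (u n) }
    1 (fun u => by
      rw [one_mul]
      refine pow_le_pow_iff_left₀ (norm_nonneg _) (norm_nonneg _) two_ne_zero |>.1 ?_
      rw [norm_sq_eq_tsum, norm_sq_eq_tsum]
      refine Summable.tsum_le_tsum (fun n => ?_) (summable_norm_sq _) (summable_norm_sq _)
      gcongr
      exact HPow.norm_map_apply_le hA n _)

/-- The components of `l(x) u`: zero in degree `0`, and `x ⊗ uₙ` in degree `n + 1`. -/
def creationFun (x : E) (u : Fock E) : (n : ℕ) → HPow E n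
  | 0 => 0
  | n + 1 => HPow.cons x (u n)

theorem summable_creationFun (x : E) (u : Fock E) :
    Summable fun n => ‖creationFun x u n‖ ^ 2 := by
  rw [← summable_nat_add_iff 1]
  simpa [creationFun, HPow.norm_cons, mul_pow] using (summable_norm_sq u).mul_left (‖x‖ ^ 2)

/-- The left creation operator `l(x)`, `l(x) (g₁ ⊗ ⋯ ⊗ gₙ) = x ⊗ g₁ ⊗ ⋯ ⊗ gₙ`. -/
def creation (x : E) : Fock E →L[ℂ] Fock E :=
  LinearMap.mkContinuous
    { toFun := fun u => ⟨creationFun x u, memℓp_gen (by simpa using summable_creationFun x u)⟩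
      map_add' := fun u v => by
        ext n
        cases n with
        | zero => exact (add_zero (0 : HPow E 0)).symm
        | succ n => exact (HPow.consL x).map_add (u n) (v n)
      map_smul' := fun c u => by
        ext n
        cases n with
        | zero => exact (smul_zero c).symm
        | succ n => exact (HPow.consL x).map_smul c (u n) }
    ‖x‖ (fun u => by
      refine pow_le_pow_iff_left₀ (norm_nonneg _) (by positivity) two_ne_zero |>.1 ?_
      rw [norm_sq_eq_tsum, mul_pow, norm_sq_eq_tsum u, ← tsum_mul_left]
      refine le_of_eq (((summable_creationFun x u).tsum_eq_zero_add).trans ?_)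
      simp [creationFun, HPow.norm_cons, mul_pow])

/-- The semicircular operator `l(x) + l(x)^*`. -/
def semicircular (x : E) : Fock E →L[ℂ] Fock E :=
  creation x + ContinuousLinearMap.adjoint (creation x)

end Fock

/-! ### The Wigner space -/

/-- Lebesgue measure on `ℝ₊ = [0, ∞)`. -/
def halfLine : Measure ℝ := volume.restrict (Set.Ici 0)

instance : SigmaFinite halfLine := by unfold halfLine; infer_instance

/-- The real Hilbert space `L²_ℝ(ℝ₊)`. -/
abbrev HReal : Type := Lp ℝ 2 halfLine

/-- Its complexification `L²_ℂ(ℝ₊)`. -/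
abbrev HComplex : Type := Lp ℂ 2 halfLine

/-- The inclusion `L²_ℝ(ℝ₊) → L²_ℂ(ℝ₊)`. -/
def complexify (h : HReal) : HComplex := Complex.ofRealCLM.compLp h

/-- The space `L²(𝒮𝒞, τ)`, realised as the free Fock space of `L²_ℂ(ℝ₊)`: an operator `X` of the von
Neumann algebra `𝒮𝒞` is the vector `X Ω`, so that `τ (Y^* X) = ⟪Y Ω, X Ω⟫`. -/
abbrev WignerL2 : Type := Fock HComplex

/-- The semicircular element `S(h)`, `h ∈ L²_ℝ(ℝ₊)`. -/
def S (h : HReal) : WignerL2 →L[ℂ] WignerL2 := semicircular (complexify h)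

/-- The monomial `S(e₁) ⋯ S(eₙ)` attached to a list of vectors of `L²_ℝ(ℝ₊)`. -/
def monomial (w : List HReal) : WignerL2 →L[ℂ] WignerL2 := (w.map S).prod

/-- The unital algebra `𝒮𝒞_alg` generated by the `S(h)`, `h ∈ L²_ℝ(ℝ₊)`, seen in `L²(𝒮𝒞)`; it is
closed under adjoints because the generators are self-adjoint. -/
def scAlg : Submodule ℂ WignerL2 :=
  Submodule.span ℂ (Set.range fun w : List HReal => monomial w (vacuum HComplex))

/-! The vacuum is cyclic: `𝒮𝒞_alg Ω` is dense in the Fock space, so that the Fock space is indeed the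
completion of `𝒮𝒞_alg` for `‖X‖₂ = ‖X Ω‖`. -/

theorem S_mem_scAlg_closure (h : HReal) {u : WignerL2} (hu : u ∈ scAlg.topologicalClosure) :
    S h u ∈ scAlg.topologicalClosure := by
  have h1 : scAlg ≤ scAlg.topologicalClosure.comap (S h).toLinearMap := by
    refine Submodule.span_le.2 ?_
    rintro _ ⟨w, rfl⟩
    exact scAlg.le_topologicalClosure (Submodule.subset_span ⟨h :: w, by simp [monomial]⟩)
  have h2 : IsClosed ((scAlg.topologicalClosure.comap (S h).toLinearMap : Submodule ℂ WignerL2) :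
      Set WignerL2) :=
    scAlg.isClosed_topologicalClosure.preimage (S h).continuous
  exact Submodule.topologicalClosure_minimal _ h1 h2 hu

theorem creation_single {E : Type} [NormedAddCommGroup E] [InnerProductSpace ℂ E] (x : E) (n : ℕ)
    (u : HPow E n) :
    creation x (lp.single 2 n u) = lp.single 2 (n + 1) (HPow.cons x u) := by
  ext m
  cases m with
  | zero => simp [creation, creationFun, lp.single_apply]
  | succ m =>
    by_cases hm : m = n
    · subst hm
      simp [creation, creationFun]
    · have hm' : m + 1 ≠ n + 1 := by omega
      change HPow.cons x ((lp.single 2 n u : Fock E) m) = _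
      rw [lp.single_apply_ne _ _ _ hm, lp.single_apply_ne _ _ _ hm']
      exact (HPow.consL x).map_zero

theorem adjoint_creation_single {E : Type} [NormedAddCommGroup E] [InnerProductSpace ℂ E] (x : E)
    (n m : ℕ) (hm : m + 1 ≠ n) (u : HPow E n) :
    (ContinuousLinearMap.adjoint (creation x) (lp.single 2 n u) : Fock E) m = 0 := by
  refine ext_inner_left ℂ fun v => ?_
  rw [inner_zero_right, ← lp.inner_single_left, ContinuousLinearMap.adjoint_inner_right,
    creation_single, lp.inner_single_left, lp.single_apply_ne _ _ _ hm, inner_zero_right]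

theorem complexify_span (g : HComplex) :
    ∃ a b : HReal, g = complexify a + Complex.I • complexify b := by
  refine ⟨Complex.reCLM.compLp g, Complex.imCLM.compLp g, ?_⟩
  ext1
  filter_upwards [Lp.coeFn_add (complexify (Complex.reCLM.compLp g))
      (Complex.I • complexify (Complex.imCLM.compLp g)),
    Lp.coeFn_smul Complex.I (complexify (Complex.imCLM.compLp g)),
    Complex.ofRealCLM.coeFn_compLp (Complex.reCLM.compLp g),
    Complex.ofRealCLM.coeFn_compLp (Complex.imCLM.compLp g),
    Complex.reCLM.coeFn_compLp g, Complex.imCLM.coeFn_compLp g] with s h1 h2 h3 h4 h5 h6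
  rw [h1, Pi.add_apply, h2, Pi.smul_apply]
  unfold complexify
  rw [h3, h4, h5, h6]
  exact (by simp [mul_comm Complex.I] :
    g s = ((g s).re : ℂ) + Complex.I * ((g s).im : ℂ))

theorem single_mem_scAlg_closure (n : ℕ) (u : HPow HComplex n) :
    (lp.single 2 n u : WignerL2) ∈ scAlg.topologicalClosure := by
  induction n using Nat.strong_induction_on with
  | _ n ih =>
  cases n with
  | zero =>
    have h0 : (lp.single 2 0 u : WignerL2) = (HPow.zeroEquiv HComplex u) • vacuum HComplex := by
      rw [vacuum, ← lp.single_smul, ← map_smul]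
      congr 1
      apply (HPow.zeroEquiv HComplex).injective
      simp
    rw [h0]
    exact Submodule.smul_mem _ _ (scAlg.le_topologicalClosure
      (Submodule.subset_span ⟨[], by simp [monomial]⟩))
  | succ n =>
    -- real creation operators preserve the closure on degree `n`
    have hreal : ∀ (h : HReal) (v : HPow HComplex n),
        (lp.single 2 (n + 1) (HPow.cons (complexify h) v) : WignerL2) ∈
          scAlg.topologicalClosure := by
      intro h v
      have h1 : (lp.single 2 (n + 1) (HPow.cons (complexify h) v) : WignerL2) =
          S h (lp.single 2 n v) -
            ContinuousLinearMap.adjoint (creation (complexify h)) (lp.single 2 n v) := by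
        simp [S, semicircular, creation_single]
      rw [h1]
      refine Submodule.sub_mem _ (S_mem_scAlg_closure h (ih n n.lt_succ_self v)) ?_
      set a : WignerL2 :=
        ContinuousLinearMap.adjoint (creation (complexify h)) (lp.single 2 n v) with ha
      have ha0 : ∀ m, m + 1 ≠ n → a m = 0 := fun m hm => adjoint_creation_single _ n m hm v
      have h2 : a = lp.single 2 (n - 1) (a (n - 1)) := by
        ext m
        by_cases hm : m = n - 1
        · subst hm; simp
        · rw [lp.single_apply_ne _ _ _ hm, ha0 m (by omega)]
      rw [h2]
      exact ih (n - 1) (by omega) _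
    -- extend from elementary tensors to the whole of the tensor power
    have hclosed : IsClosed {v : Completion (HComplex ⊗[ℂ] HPow HComplex n) |
        (lp.single 2 (n + 1) ((HPow.succEquiv HComplex n).symm v) : WignerL2) ∈
          scAlg.topologicalClosure} := by
      refine scAlg.isClosed_topologicalClosure.preimage ?_
      exact (lp.singleContinuousLinearMap ℂ (fun n => HPow HComplex n) 2 (n + 1)).continuous.comp
        (HPow.succEquiv HComplex n).symm.continuous
    have hall : ∀ v : Completion (HComplex ⊗[ℂ] HPow HComplex n),
        (lp.single 2 (n + 1) ((HPow.succEquiv HComplex n).symm v) : WignerL2) ∈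
          scAlg.topologicalClosure := by
      intro v
      induction v using Completion.induction_on with
      | hp => exact hclosed
      | ih z =>
        induction z using TensorProduct.induction_on with
        | zero =>
          rw [Completion.coe_zero, map_zero, lp.single_zero]
          exact Submodule.zero_mem _
        | add z z' hz hz' =>
          rw [Completion.coe_add, map_add, lp.single_add]
          exact Submodule.add_mem _ hz hz'
        | tmul g v =>
          obtain ⟨a, b, rfl⟩ := complexify_span g
          rw [TensorProduct.add_tmul, ← TensorProduct.smul_tmul', Completion.coe_add,
            Completion.coe_smul, map_add, map_smul, lp.single_add, lp.single_smul]
          exact Submodule.add_mem _ (hreal a v) (Submodule.smul_mem _ _ (hreal b v))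
    simpa using hall (HPow.succEquiv HComplex n u)

theorem scAlg_topologicalClosure : scAlg.topologicalClosure = ⊤ := by
  refine eq_top_iff.2 fun u _ => ?_
  exact scAlg.isClosed_topologicalClosure.mem_of_tendsto (lp.hasSum_single (by norm_num) u)
    (Filter.Eventually.of_forall fun s =>
      Submodule.sum_mem _ fun n _ => single_mem_scAlg_closure n (u n))

/-- `L²(𝒮𝒞^{⊗n}, τ^{⊗n}) = L²(𝒮𝒞, τ)^{⊗n}`. -/
abbrev WignerL2Pow (n : ℕ) : Type := HPow WignerL2 n

/-- `𝕄₂^{k,n} = L²(ℝ₊ᵏ, L²(𝒮𝒞^{⊗n}))`. -/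
abbrev MField (k n : ℕ) : Type := Lp (WignerL2Pow n) 2 (Measure.pi fun _ : Fin k => halfLine)

/-! ### Iterated free Malliavin derivatives -/

/-- The terms of the free Malliavin derivative of a monomial: the triple `(a, h, b)` stands for
`h · S(a) ⊗ S(b)`. The recursion is the Leibniz rule
`∇ (S(e) W) = e · 1 ⊗ W + S(e) · ∇ W`, with `∇ 1 = 0`. -/
def malliavinTerms : List HReal → List (List HReal × HReal × List HReal)
  | [] => []
  | e :: w => ([], e, w) :: (malliavinTerms w).map fun p => (e :: p.1, p.2.1, p.2.2)

/-- The derivation property `∇ (A B) = ∇ A · B + A · ∇ B` on monomials. -/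
theorem malliavinTerms_append (u v : List HReal) :
    malliavinTerms (u ++ v) =
      (malliavinTerms u).map (fun p => (p.1, p.2.1, p.2.2 ++ v)) ++
        (malliavinTerms v).map (fun p => (u ++ p.1, p.2.1, p.2.2)) := by
  induction u with
  | nil => simp [malliavinTerms]
  | cons e u ih => simp [malliavinTerms, ih, Function.comp_def]

/-- The field `(t₁, …, tₖ) ↦ ∇ᵏ_{t₁,…,tₖ} F` for a monomial `F = S(w)`, where
`∇ᵏ = (id^{⊗(k-1)} ⊗ ∇_{tₖ}) ∘ ⋯ ∘ (id ⊗ ∇_{t₂}) ∘ ∇_{t₁}`: if `∇_{t₁} F = ∑ h(t₁) S(a) ⊗ S(b)`,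
then `∇ᵏ_{t₁,…,tₖ} F = ∑ h(t₁) S(a) ⊗ ∇ᵏ⁻¹_{t₂,…,tₖ} S(b)`. -/
def nablaFun : (k : ℕ) → List HReal → (Fin k → ℝ) → WignerL2Pow (k + 1)
  | 0, w, _ => HPow.cons (monomial w (vacuum HComplex)) ((HPow.zeroEquiv WignerL2).symm 1)
  | k + 1, w, t =>
    ((malliavinTerms w).map fun p =>
      ((p.2.1 (t 0) : ℝ) : ℂ) •
        HPow.cons (monomial p.1 (vacuum HComplex)) (nablaFun k p.2.2 (Fin.tail t))).sum

theorem measurePreserving_head_tail (k : ℕ) :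
    MeasurePreserving (fun t : Fin (k + 1) → ℝ => (t 0, Fin.tail t))
      (Measure.pi fun _ => halfLine) (halfLine.prod (Measure.pi fun _ : Fin k => halfLine)) :=
  measurePreserving_piFinSuccAbove (fun _ : Fin (k + 1) => halfLine) 0

theorem memLp_smul_cons {k n : ℕ} (h : HReal) (x : WignerL2) {g : (Fin k → ℝ) → WignerL2Pow n}
    (hg : MemLp g 2 (Measure.pi fun _ => halfLine)) :
    MemLp (fun t : Fin (k + 1) → ℝ => ((h (t 0) : ℝ) : ℂ) • HPow.cons x (g (Fin.tail t))) 2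
      (Measure.pi fun _ => halfLine) := by
  have h1 : AEStronglyMeasurable (fun q : ℝ × (Fin k → ℝ) => ((h q.1 : ℝ) : ℂ))
      (halfLine.prod (Measure.pi fun _ : Fin k => halfLine)) :=
    Complex.continuous_ofReal.comp_aestronglyMeasurable (Lp.aestronglyMeasurable h).comp_fst
  have h2 : AEStronglyMeasurable (fun q : ℝ × (Fin k → ℝ) => HPow.cons x (g q.2))
      (halfLine.prod (Measure.pi fun _ : Fin k => halfLine)) :=
    (HPow.consL x).continuous.comp_aestronglyMeasurable hg.1.comp_snd
  have h3 : AEStronglyMeasurable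
      (fun q : ℝ × (Fin k → ℝ) => ((h q.1 : ℝ) : ℂ) • HPow.cons x (g q.2))
      (halfLine.prod (Measure.pi fun _ : Fin k => halfLine)) := h1.smul h2
  have i1 : Integrable (fun s => ‖h s‖ ^ 2) halfLine :=
    (memLp_two_iff_integrable_sq_norm (Lp.memLp h).1).1 (Lp.memLp h)
  have i2 : Integrable (fun s => ‖g s‖ ^ 2) (Measure.pi fun _ : Fin k => halfLine) :=
    (memLp_two_iff_integrable_sq_norm hg.1).1 hg
  have key : MemLp (fun q : ℝ × (Fin k → ℝ) => ((h q.1 : ℝ) : ℂ) • HPow.cons x (g q.2)) 2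
      (halfLine.prod (Measure.pi fun _ : Fin k => halfLine)) := by
    refine (memLp_two_iff_integrable_sq_norm h3).2 ?_
    refine ((i1.mul_prod i2).const_mul (‖x‖ ^ 2)).congr (Filter.Eventually.of_forall fun q => ?_)
    simp only [norm_smul, HPow.norm_cons, Complex.norm_real]
    ring
  have := key.comp_measurePreserving (measurePreserving_head_tail k)
  exact this

theorem memLp_nablaFun (k : ℕ) (w : List HReal) :
    MemLp (nablaFun k w) 2 (Measure.pi fun _ : Fin k => halfLine) := by
  induction k generalizing w with
  | zero =>
    have : IsFiniteMeasure (Measure.pi fun _ : Fin 0 => halfLine) := by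
      rw [Measure.pi_of_empty]; infer_instance
    exact memLp_const (HPow.cons (monomial w (vacuum HComplex)) ((HPow.zeroEquiv WignerL2).symm 1))
  | succ k ih =>
    have : ∀ l : List (List HReal × HReal × List HReal),
        MemLp (fun t : Fin (k + 1) → ℝ => (l.map fun p =>
          ((p.2.1 (t 0) : ℝ) : ℂ) • HPow.cons (monomial p.1 (vacuum HComplex))
            (nablaFun k p.2.2 (Fin.tail t))).sum) 2 (Measure.pi fun _ => halfLine) := by
      intro l
      induction l with
      | nil => simp
      | cons p l ihl =>
        simp only [List.map_cons, List.sum_cons]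
        exact (memLp_smul_cons p.2.1 (monomial p.1 (vacuum HComplex)) (ih p.2.2)).add ihl
    exact this (malliavinTerms w)

/-- `∇ᵏ S(w)` as an element of `𝕄₂^{k,k+1}`. -/
def nablaMonomial (k : ℕ) (w : List HReal) : MField k (k + 1) := (memLp_nablaFun k w).toLp

/-- The graph of the linear operator `∇ᵏ : 𝒮𝒞_alg → 𝕄₂^{k,k+1}`. -/
def nablaGraph (k : ℕ) : Submodule ℂ (WignerL2 × MField k (k + 1)) :=
  Submodule.span ℂ
    (Set.range fun w : List HReal => (monomial w (vacuum HComplex), nablaMonomial k w))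

/-- The closure of `∇ᵏ`, as an unbounded operator from `L²(𝒮𝒞)` to `𝕄₂^{k,k+1}`. Its domain
`(nabla k).domain` is the Sobolev-Wigner space `𝔻^{k,2}`. -/
def nabla (k : ℕ) : WignerL2 →ₗ.[ℂ] MField k (k + 1) :=
  (nablaGraph k).topologicalClosure.toLinearPMap

/-! ### The free Ornstein-Uhlenbeck semigroup -/

theorem norm_exp_smul_id_le (t : ℝ≥0) :
    ‖((Real.exp (-t) : ℝ) : ℂ) • ContinuousLinearMap.id ℂ HComplex‖ ≤ 1 := by
  refine ContinuousLinearMap.opNorm_le_bound _ zero_le_one fun x => ?_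
  simp only [smul_apply, ContinuousLinearMap.id_apply, norm_smul,
    Complex.norm_real, Real.norm_eq_abs, Real.abs_exp]
  gcongr
  simp

/-- The free Ornstein-Uhlenbeck operator `P_t`: the second quantization of `e^{-t} id`. -/
def ouP (t : ℝ≥0) : WignerL2 →L[ℂ] WignerL2 :=
  secondQuantization (((Real.exp (-t) : ℝ) : ℂ) • ContinuousLinearMap.id ℂ HComplex)
    (norm_exp_smul_id_le t)

/-- `P_t^{⊗n}` acting on `𝕄₂^{k,n}`, i.e. pointwise in `(t₁, …, tₖ)`. -/
def ouPField (t : ℝ≥0) (k n : ℕ) : MField k n →L[ℂ] MField k n :=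
  (HPow.map (ouP t) n).compLpL 2 (Measure.pi fun _ : Fin k => halfLine)

end FreeWigner

end

/-! The argument replaces monomials in the `S(h)` by words in creation operators, on which all
operators are explicit. A vector is carried together with its derivatives of every order. Left
multiplication by `S(h)` then lifts to one linear operator on `FieldSeq`: by Leibniz, `∇ᵏ(S(h)F) =
(S(h) ⊗ 1)∇ᵏF + h(t₁) Ω ⊗ ∇ᵏ⁻¹F`. The second term is attached to the creation part. Since `l(h)^*`
kills the inserted `Ω`, the lifted operators still satisfy `l(h)^* l(h') = ⟨h, h'⟩` and annihilate
the vacuum sequence. So monomials and creation words have the same span (`monomialSeq_mem_span`,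
`wickSeq_mem_span`), and the graph of `∇ᵏ` may be tested on the words `h₁ ⊗ ⋯ ⊗ hₙ`. Commutation:
`P_t` multiplies such a word by `e^{-nt}`. Its `k`-th derivative has total degree `n - k`, so
`e^{-kt} P_t^{⊗(k+1)}` multiplies the derivative by the same number (`ouSeq_wickSeq`). The bounded
pair `ouPair` thus preserves the graph, hence its closure. Closability: on elementary tensor fields
the adjoint of `∇ᵏ` is concatenation, putting each function `hᵢ` back between the neighbouring
tensor legs (`IsTestField.integral_inner_wickSeq`). If `(0, G)` is in the closed graph, `G` is
orthogonal to all these fields. They include indicators of boxes times a total set of vectors, so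
every box integral of `G` vanishes and `G = 0`. -/

noncomputable section

namespace FreeWigner

/-! ### Words in creation and annihilation operators -/

section Words

variable {ι M : Type*} [AddCommGroup M] [Module ℂ M]

/-- The vector `T e₁ (T e₂ (⋯ (T eₙ o)))` for a family of linear maps `T`. -/
def wordVec (T : ι → M →ₗ[ℂ] M) (o : M) (w : List ι) : M := w.foldr (fun e v => T e v) o

@[simp] theorem wordVec_nil (T : ι → M →ₗ[ℂ] M) (o : M) : wordVec T o [] = o := rfl

@[simp] theorem wordVec_cons (T : ι → M →ₗ[ℂ] M) (o : M) (e : ι) (w : List ι) :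
    wordVec T o (e :: w) = T e (wordVec T o w) := rfl

variable {L B : ι → M →ₗ[ℂ] M} {o : M} {c : ι → ι → ℂ}

/-- The hypotheses are the free Fock relations: annihilation kills the vacuum and cancels the
adjacent creator with no commutator remainder, so it only ever removes the first letter. -/
theorem annihilate_wordVec (hB : ∀ e, B e o = 0) (hBL : ∀ e e' v, B e (L e' v) = c e e' • v)
    (e : ι) (w : List ι) :
    B e (wordVec L o w) = 0 ∨ ∃ a : ℂ, B e (wordVec L o w) = a • wordVec L o w.tail := by
  cases w with
  | nil => exact Or.inl (hB e)
  | cons e' w => exact Or.inr ⟨c e e', hBL e e' _⟩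

theorem wordVec_add_mem_span (hB : ∀ e, B e o = 0) (hBL : ∀ e e' v, B e (L e' v) = c e e' • v)
    (w : List ι) :
    wordVec (fun e => L e + B e) o w ∈ Submodule.span ℂ (Set.range (wordVec L o)) := by
  induction w with
  | nil => exact Submodule.subset_span ⟨[], rfl⟩
  | cons e w ih =>
    have h : Submodule.span ℂ (Set.range (wordVec L o)) ≤
        (Submodule.span ℂ (Set.range (wordVec L o))).comap (L e + B e) := by
      refine Submodule.span_le.2 ?_
      rintro _ ⟨v, rfl⟩
      have h1 : B e (wordVec L o v) ∈ Submodule.span ℂ (Set.range (wordVec L o)) := by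
        rcases annihilate_wordVec hB hBL e v with h | ⟨a, h⟩
        · exact h ▸ Submodule.zero_mem _
        · exact h ▸ Submodule.smul_mem _ _ (Submodule.subset_span ⟨_, rfl⟩)
      have h2 : L e (wordVec L o v) ∈ Submodule.span ℂ (Set.range (wordVec L o)) :=
        Submodule.subset_span ⟨e :: v, rfl⟩
      exact Submodule.add_mem _ h2 h1
    exact h ih

/-- The change from `L`-words to `(L + B)`-words is triangular in the length: the correction term is
a multiple of a shorter `L`-word. -/
theorem wordVec_mem_span_add (hB : ∀ e, B e o = 0) (hBL : ∀ e e' v, B e (L e' v) = c e e' • v)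
    (w : List ι) :
    wordVec L o w ∈ Submodule.span ℂ (Set.range (wordVec (fun e => L e + B e) o)) := by
  set N := Submodule.span ℂ (Set.range (wordVec (fun e => L e + B e) o)) with hN
  have hadd : ∀ e, N ≤ N.comap (L e + B e) := by
    intro e
    refine Submodule.span_le.2 ?_
    rintro _ ⟨v, rfl⟩
    exact Submodule.subset_span ⟨e :: v, rfl⟩
  -- Induction on a bound for the length, because the correction involves the tail of the tail.
  have key : ∀ n (w : List ι), w.length ≤ n → wordVec L o w ∈ N := by
    intro n
    induction n with
    | zero =>
      intro w hw
      obtain rfl := List.length_eq_zero_iff.1 (Nat.le_zero.1 hw)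
      exact Submodule.subset_span ⟨[], rfl⟩
    | succ n ih =>
      intro w hw
      cases w with
      | nil => exact Submodule.subset_span ⟨[], rfl⟩
      | cons e w =>
        have hw' : w.length ≤ n := by simpa using hw
        have h1 : wordVec L o (e :: w) = (L e + B e) (wordVec L o w) - B e (wordVec L o w) := by
          simp
        rw [h1]
        refine Submodule.sub_mem _ (hadd e (ih w hw')) ?_
        rcases annihilate_wordVec hB hBL e w with h | ⟨a, h⟩
        · exact h ▸ Submodule.zero_mem _
        · exact h ▸ Submodule.smul_mem _ _ (ih _ (by simp; omega))
  exact key _ w le_rfl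

end Words

/-! ### Operators on the first tensor factor -/

section Head

variable {E : Type} [NormedAddCommGroup E] [InnerProductSpace ℂ E]

theorem HPow.inner_cons {n : ℕ} (x y : E) (u v : HPow E n) :
    inner ℂ (HPow.cons x u) (HPow.cons y v) = inner ℂ x y * inner ℂ u v := by
  simp [HPow.cons]

/-- `x ↦ x ⊗ u` as a bounded operator `E → E^{⊗(n+1)}`. -/
def HPow.consR {n : ℕ} (u : HPow E n) : E →L[ℂ] HPow E (n + 1) :=
  LinearMap.mkContinuous
    { toFun := fun x => HPow.cons x u
      map_add' := fun x y => by
        simp only [HPow.cons, TensorProduct.add_tmul, Completion.coe_add, map_add]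
      map_smul' := fun c x => by
        simp only [HPow.cons, ← TensorProduct.smul_tmul', Completion.coe_smul, map_smul,
          RingHom.id_apply] }
    ‖u‖ (fun x => by
      rw [mul_comm]
      exact (HPow.norm_cons x u).le)

@[simp] theorem HPow.consR_apply {n : ℕ} (u : HPow E n) (x : E) :
    HPow.consR u x = HPow.cons x u := rfl

theorem HPow.cons_zero_left {n : ℕ} (u : HPow E n) : HPow.cons (0 : E) u = 0 :=
  (HPow.consR u).map_zero

theorem HPow.cons_add_left {n : ℕ} (x y : E) (u : HPow E n) :
    HPow.cons (x + y) u = HPow.cons x u + HPow.cons y u := (HPow.consR u).map_add x y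

theorem HPow.cons_smul_left {n : ℕ} (c : ℂ) (x : E) (u : HPow E n) :
    HPow.cons (c • x) u = c • HPow.cons x u := (HPow.consR u).map_smul c x

theorem HPow.cons_add_right {n : ℕ} (x : E) (u v : HPow E n) :
    HPow.cons x (u + v) = HPow.cons x u + HPow.cons x v := (HPow.consL x).map_add u v

theorem HPow.cons_smul_right {n : ℕ} (c : ℂ) (x : E) (u : HPow E n) :
    HPow.cons x (c • u) = c • HPow.cons x u := (HPow.consL x).map_smul c u

/-- Elementary tensors span a dense subspace of `E^{⊗(n+1)}`. -/
theorem HPow.cons_induction {n : ℕ} {K : Submodule ℂ (HPow E (n + 1))}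
    (hK : IsClosed (K : Set (HPow E (n + 1)))) (h : ∀ x (u : HPow E n), HPow.cons x u ∈ K)
    (z : HPow E (n + 1)) : z ∈ K := by
  have hall : ∀ v : Completion (E ⊗[ℂ] HPow E n), (HPow.succEquiv E n).symm v ∈ K := by
    intro v
    induction v using Completion.induction_on with
    | hp => exact hK.preimage (HPow.succEquiv E n).symm.continuous
    | ih z =>
      induction z using TensorProduct.induction_on with
      | zero =>
        rw [Completion.coe_zero, map_zero]
        exact K.zero_mem
      | add z z' hz hz' =>
        rw [Completion.coe_add, map_add]
        exact K.add_mem hz hz'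
      | tmul x u => exact h x u
  simpa using hall (HPow.succEquiv E n z)

theorem HPow.clm_ext {F : Type*} [NormedAddCommGroup F] [NormedSpace ℂ F] {n : ℕ}
    {f g : HPow E (n + 1) →L[ℂ] F} (h : ∀ x (u : HPow E n), f (HPow.cons x u) = g (HPow.cons x u)) :
    f = g := by
  ext z
  have : z ∈ (f - g).ker :=
    HPow.cons_induction (f - g).isClosed_ker (fun x u => by simp [h]) z
  simpa [sub_eq_zero] using this

theorem HPow.eq_zero_of_inner_cons {n : ℕ} {z : HPow E (n + 1)}
    (h : ∀ x (u : HPow E n), inner ℂ (HPow.cons x u) z = 0) : z = 0 := by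
  have h1 : innerSL ℂ z = 0 := HPow.clm_ext fun x u => by
    simpa using inner_eq_zero_symm.1 (h x u)
  simpa using congrArg (fun f => f z) h1

/-- The operator `A ⊗ 1 ⊗ ⋯ ⊗ 1` on `E^{⊗(n+1)}`. -/
def HPow.headMap (A : E →L[ℂ] E) (n : ℕ) : HPow E (n + 1) →L[ℂ] HPow E (n + 1) :=
  (HPow.succEquiv E n).symm.toContinuousLinearEquiv.toContinuousLinearMap ∘L
    (TensorProduct.mapL A (ContinuousLinearMap.id ℂ (HPow E n))).completion ∘L
      (HPow.succEquiv E n).toContinuousLinearEquiv.toContinuousLinearMap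

@[simp] theorem HPow.headMap_cons (A : E →L[ℂ] E) {n : ℕ} (x : E) (u : HPow E n) :
    HPow.headMap A n (HPow.cons x u) = HPow.cons (A x) u := by
  simp [HPow.headMap, HPow.cons]

theorem HPow.headMap_add (A B : E →L[ℂ] E) (n : ℕ) :
    HPow.headMap (A + B) n = HPow.headMap A n + HPow.headMap B n :=
  HPow.clm_ext fun x u => by simp [HPow.cons_add_left]

theorem HPow.headMap_headMap_of_comp_eq {A B : E →L[ℂ] E} {c : ℂ} (h : ∀ x, A (B x) = c • x)
    {n : ℕ} (z : HPow E (n + 1)) : HPow.headMap A n (HPow.headMap B n z) = c • z := by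
  have h1 : HPow.headMap A n ∘L HPow.headMap B n = c • ContinuousLinearMap.id ℂ _ :=
    HPow.clm_ext fun x u => by simp [h, HPow.cons_smul_left]
  exact congrArg (fun f => f z) h1

theorem HPow.inner_headMap_left [CompleteSpace E] (A : E →L[ℂ] E) {n : ℕ} (y z : HPow E (n + 1)) :
    inner ℂ (HPow.headMap A n y) z =
      inner ℂ y (HPow.headMap (ContinuousLinearMap.adjoint A) n z) := by
  have h1 : ContinuousLinearMap.adjoint (HPow.headMap A n) =
      HPow.headMap (ContinuousLinearMap.adjoint A) n := by
    refine HPow.clm_ext fun x u => sub_eq_zero.1 (HPow.eq_zero_of_inner_cons fun x' u' => ?_)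
    rw [inner_sub_right, ContinuousLinearMap.adjoint_inner_right, HPow.headMap_cons,
      HPow.headMap_cons, HPow.inner_cons, HPow.inner_cons, ContinuousLinearMap.adjoint_inner_right,
      sub_self]
  rw [← h1, ContinuousLinearMap.adjoint_inner_right]

/-- Used with `A = P_t`, `B = l(h)`, `c = e^{-t}`: only the first leg sees `B`, so a single factor
`c` appears whatever the number of legs. -/
theorem HPow.map_headMap {A B : E →L[ℂ] E} {c : ℂ} (h : ∀ x, A (B x) = c • B (A x)) {n : ℕ}
    (z : HPow E (n + 1)) :
    HPow.map A (n + 1) (HPow.headMap B n z) = c • HPow.headMap B n (HPow.map A (n + 1) z) := by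
  have h1 : HPow.map A (n + 1) ∘L HPow.headMap B n =
      c • (HPow.headMap B n ∘L HPow.map A (n + 1)) :=
    HPow.clm_ext fun x u => by simp [HPow.map_cons, h, HPow.cons_smul_left]
  exact congrArg (fun f => f z) h1

end Head

/-! ### Relations on the Fock space -/

section FockRelations

variable {E : Type} [NormedAddCommGroup E] [InnerProductSpace ℂ E]

theorem creation_apply_zero (x : E) (u : Fock E) : (creation x u : Fock E) 0 = 0 := rfl

theorem creation_apply_succ (x : E) (u : Fock E) (n : ℕ) :
    (creation x u : Fock E) (n + 1) = HPow.cons x (u n) := rfl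

theorem inner_creation_creation (x y : E) (u v : Fock E) :
    inner ℂ (creation x u) (creation y v) = inner ℂ x y * inner ℂ u v := by
  have h := lp.summable_inner (𝕜 := ℂ) (creation x u) (creation y v)
  rw [lp.inner_eq_tsum, h.tsum_eq_zero_add, lp.inner_eq_tsum, ← tsum_mul_left,
    creation_apply_zero, inner_zero_left, zero_add]
  simp_rw [creation_apply_succ, HPow.inner_cons]

theorem adjoint_creation_creation (x y : E) (u : Fock E) :
    ContinuousLinearMap.adjoint (creation x) (creation y u) = (inner ℂ x y : ℂ) • u := by
  refine ext_inner_left ℂ fun v => ?_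
  rw [ContinuousLinearMap.adjoint_inner_right, inner_creation_creation, inner_smul_right]

theorem inner_creation_vacuum (x : E) (u : Fock E) : inner ℂ (creation x u) (vacuum E) = 0 := by
  rw [vacuum, lp.inner_single_right, creation_apply_zero, inner_zero_left]

theorem adjoint_creation_vacuum (x : E) :
    ContinuousLinearMap.adjoint (creation x) (vacuum E) = 0 := by
  refine ext_inner_left ℂ fun v => ?_
  rw [ContinuousLinearMap.adjoint_inner_right, inner_creation_vacuum, inner_zero_right]

theorem inner_vacuum_vacuum : inner ℂ (vacuum E) (vacuum E) = (1 : ℂ) := by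
  rw [vacuum, lp.inner_single_right, lp.single_apply_self, LinearIsometryEquiv.inner_map_map]
  simp

theorem secondQuantization_apply (A : E →L[ℂ] E) (hA : ‖A‖ ≤ 1) (u : Fock E) (n : ℕ) :
    (secondQuantization A hA u : Fock E) n = HPow.map A n (u n) := rfl

theorem secondQuantization_vacuum (A : E →L[ℂ] E) (hA : ‖A‖ ≤ 1) :
    secondQuantization A hA (vacuum E) = vacuum E := by
  ext n
  rw [secondQuantization_apply]
  cases n with
  | zero => rfl
  | succ n => rw [vacuum, lp.single_apply_ne _ _ _ (Nat.succ_ne_zero n), map_zero]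

theorem secondQuantization_creation (A : E →L[ℂ] E) (hA : ‖A‖ ≤ 1) (x : E) (u : Fock E) :
    secondQuantization A hA (creation x u) = creation (A x) (secondQuantization A hA u) := by
  ext n
  rw [secondQuantization_apply]
  cases n with
  | zero => rw [creation_apply_zero, map_zero, creation_apply_zero]
  | succ n => rw [creation_apply_succ, HPow.map_cons, creation_apply_succ, secondQuantization_apply]

theorem creation_smul (c : ℂ) (x : E) (u : Fock E) : creation (c • x) u = c • creation x u := by
  ext n
  cases n with
  | zero => simp [creation_apply_zero]
  | succ n => simp [creation_apply_succ, HPow.cons_smul_left]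

end FockRelations

/-! ### Iterated derivatives of all orders -/

/-- Vectors of `L²(𝒮𝒞)` together with candidates for all their iterated derivatives. -/
abbrev FieldSeq : Type := WignerL2 × ((k : ℕ) → (Fin k → ℝ) → WignerL2Pow (k + 1))

/-- The operator acting as `A` on the vector and as `A ⊗ 1 ⊗ ⋯ ⊗ 1` on the fields. -/
def headOp (A : WignerL2 →L[ℂ] WignerL2) : FieldSeq →ₗ[ℂ] FieldSeq where
  toFun φ := (A φ.1, fun k t => HPow.headMap A k (φ.2 k t))
  map_add' φ ψ := by
    ext1
    · simp
    · funext k t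
      simp
  map_smul' c φ := by
    ext1
    · simp
    · funext k t
      simp

/-- The field `(t₁, …, tₖ₊₁) ↦ h(t₁) Ω ⊗ φ(t₂, …, tₖ₊₁)`. -/
def insertField (h : HReal) {k : ℕ} (φ : (Fin k → ℝ) → WignerL2Pow (k + 1))
    (t : Fin (k + 1) → ℝ) : WignerL2Pow (k + 2) :=
  ((h (t 0) : ℝ) : ℂ) • HPow.cons (vacuum HComplex) (φ (Fin.tail t))

/-- The operator raising the order of the fields by `insertField`. -/
def insertOp (h : HReal) : FieldSeq →ₗ[ℂ] FieldSeq where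
  toFun φ := (0, fun
    | 0, _ => 0
    | k + 1, t => insertField h (φ.2 k) t)
  map_add' φ ψ := by
    ext1
    · simp
    · funext k t
      cases k with
      | zero => simp
      | succ k => simp [insertField, HPow.cons_add_right]
  map_smul' c φ := by
    ext1
    · simp
    · funext k t
      cases k with
      | zero => simp
      | succ k => simp [insertField, HPow.cons_smul_right, smul_comm c]

/-- The vacuum together with its iterated derivatives. -/
def vacuumSeq : FieldSeq := (vacuum HComplex, fun
  | 0, _ => HPow.cons (vacuum HComplex) ((HPow.zeroEquiv WignerL2).symm 1)
  | _ + 1, _ => 0)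

/-- Left creation by `h`, extended to the iterated derivatives. -/
def createOp (h : HReal) : FieldSeq →ₗ[ℂ] FieldSeq :=
  headOp (creation (complexify h)) + insertOp h

/-- Left annihilation by `h`, extended to the iterated derivatives. -/
def annihilateOp (h : HReal) : FieldSeq →ₗ[ℂ] FieldSeq :=
  headOp (ContinuousLinearMap.adjoint (creation (complexify h)))

/-- The elementary tensor `e₁ ⊗ ⋯ ⊗ eₙ` with its iterated derivatives. -/
def wickSeq (w : List HReal) : FieldSeq := wordVec createOp vacuumSeq w

/-- The monomial `S(e₁) ⋯ S(eₙ)` with its iterated derivatives. -/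
def monomialSeq (w : List HReal) : FieldSeq :=
  wordVec (fun h => createOp h + annihilateOp h) vacuumSeq w

theorem wickSeq_nil : wickSeq [] = vacuumSeq := rfl

theorem wickSeq_cons (h : HReal) (w : List HReal) :
    wickSeq (h :: w) = createOp h (wickSeq w) := rfl

theorem wickSeq_cons_fst (h : HReal) (w : List HReal) :
    (wickSeq (h :: w)).1 = creation (complexify h) (wickSeq w).1 := by
  rw [wickSeq_cons]
  simp [createOp, headOp, insertOp]

theorem wickSeq_cons_snd_succ (h : HReal) (w : List HReal) (k : ℕ) (t : Fin (k + 1) → ℝ) :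
    (wickSeq (h :: w)).2 (k + 1) t =
      HPow.headMap (creation (complexify h)) (k + 1) ((wickSeq w).2 (k + 1) t) +
        insertField h ((wickSeq w).2 k) t := rfl

theorem annihilateOp_vacuumSeq (h : HReal) : annihilateOp h vacuumSeq = 0 := by
  ext1
  · exact adjoint_creation_vacuum _
  · funext k t
    cases k with
    | zero => simp [annihilateOp, headOp, vacuumSeq, adjoint_creation_vacuum, HPow.cons_zero_left]
    | succ k => simp [annihilateOp, headOp, vacuumSeq]

/-- The first leg of an inserted field is the vacuum. This is why the Leibniz term does not disturb
the free relations. -/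
theorem annihilateOp_insertOp (h h' : HReal) (φ : FieldSeq) :
    annihilateOp h (insertOp h' φ) = 0 := by
  ext1
  · simp [annihilateOp, headOp, insertOp]
  · funext k t
    cases k with
    | zero => simp [annihilateOp, headOp, insertOp]
    | succ k =>
      simp [annihilateOp, headOp, insertOp, insertField, adjoint_creation_vacuum,
        HPow.cons_zero_left]

theorem annihilateOp_createOp (h h' : HReal) (φ : FieldSeq) :
    annihilateOp h (createOp h' φ) = (inner ℂ (complexify h) (complexify h') : ℂ) • φ := by
  have h1 : annihilateOp h (headOp (creation (complexify h')) φ) =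
      (inner ℂ (complexify h) (complexify h') : ℂ) • φ := by
    ext1
    · exact adjoint_creation_creation _ _ _
    · funext k t
      exact HPow.headMap_headMap_of_comp_eq (adjoint_creation_creation _ _) _
  rw [createOp, LinearMap.add_apply, map_add, annihilateOp_insertOp, add_zero, h1]

/-- Together with `wickSeq_mem_span`, this is the passage between monomials and elementary tensors,
for all orders of derivation at once. -/
theorem monomialSeq_mem_span (w : List HReal) :
    monomialSeq w ∈ Submodule.span ℂ (Set.range wickSeq) :=
  wordVec_add_mem_span annihilateOp_vacuumSeq annihilateOp_createOp w

theorem wickSeq_mem_span (w : List HReal) :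
    wickSeq w ∈ Submodule.span ℂ (Set.range monomialSeq) :=
  wordVec_mem_span_add annihilateOp_vacuumSeq annihilateOp_createOp w

theorem nablaFun_zero_cons (h : HReal) (w : List HReal) (t : Fin 0 → ℝ) :
    nablaFun 0 (h :: w) t = HPow.headMap (S h) 0 (nablaFun 0 w t) := by
  simp [nablaFun, monomial]

/-- Leibniz rule for the leading letter: either `h` is differentiated, leaving an empty left leg, or
it stays as a left factor in the first leg. -/
theorem nablaFun_succ_cons (k : ℕ) (h : HReal) (w : List HReal) (t : Fin (k + 1) → ℝ) :
    nablaFun (k + 1) (h :: w) t =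
      insertField h (nablaFun k w) t + HPow.headMap (S h) (k + 1) (nablaFun (k + 1) w t) := by
  -- Stated for an arbitrary list of terms, since only linearity in the first leg is used.
  have h1 : ∀ l : List (List HReal × HReal × List HReal),
      (l.map fun p => ((p.2.1 (t 0) : ℝ) : ℂ) • HPow.cons (monomial (h :: p.1) (vacuum HComplex))
        (nablaFun k p.2.2 (Fin.tail t))).sum =
      HPow.headMap (S h) (k + 1) (l.map fun p => ((p.2.1 (t 0) : ℝ) : ℂ) •
        HPow.cons (monomial p.1 (vacuum HComplex)) (nablaFun k p.2.2 (Fin.tail t))).sum := by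
    intro l
    induction l with
    | nil => simp
    | cons p l ih =>
      rw [List.map_cons, List.sum_cons, ih, List.map_cons, List.sum_cons, map_add, map_smul,
        HPow.headMap_cons]
      simp [monomial]
  simp only [nablaFun, malliavinTerms, List.map_cons, List.sum_cons, List.map_map,
    Function.comp_def, insertField]
  rw [h1]
  simp [monomial]

theorem monomialSeq_eq (w : List HReal) :
    monomialSeq w = (monomial w (vacuum HComplex), fun k t => nablaFun k w t) := by
  induction w with
  | nil =>
    ext1
    · rfl
    · funext k t
      cases k with
      | zero => rfl
      | succ k => rfl
  | cons h w ih =>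
    have h1 : monomialSeq (h :: w) = createOp h (monomialSeq w) + annihilateOp h (monomialSeq w) :=
      rfl
    rw [h1, ih]
    ext1
    · simp [createOp, annihilateOp, headOp, insertOp, monomial, S, semicircular]
    · funext k t
      cases k with
      | zero =>
        change _ = nablaFun 0 (h :: w) t
        rw [nablaFun_zero_cons, S, semicircular, HPow.headMap_add]
        simp [createOp, annihilateOp, headOp, insertOp]
      | succ k =>
        change _ = nablaFun (k + 1) (h :: w) t
        rw [nablaFun_succ_cons, S, semicircular, HPow.headMap_add]
        simp [createOp, annihilateOp, headOp, insertOp]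
        abel

/-! ### The graph of the derivative and Wick products -/

/-- The pairs `(u, φ)` whose field of order `k` is square integrable and lies with `u` in `G`. -/
def liftSeq (k : ℕ) (G : Submodule ℂ (WignerL2 × MField k (k + 1))) : Submodule ℂ FieldSeq where
  carrier := {φ | ∃ h : MemLp (φ.2 k) 2 (Measure.pi fun _ : Fin k => halfLine),
    (φ.1, h.toLp) ∈ G}
  zero_mem' := ⟨MemLp.zero, by
    have : (MemLp.toLp (0 : (Fin k → ℝ) → WignerL2Pow (k + 1)) MemLp.zero :
      MField k (k + 1)) = 0 := rfl
    exact G.zero_mem⟩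
  add_mem' := by
    rintro φ ψ ⟨h, hG⟩ ⟨h', hG'⟩
    exact ⟨h.add h', G.add_mem hG hG'⟩
  smul_mem' := by
    rintro c φ ⟨h, hG⟩
    exact ⟨h.const_smul c, G.smul_mem c hG⟩

theorem wickSeq_mem_liftSeq_nablaGraph (k : ℕ) (w : List HReal) :
    wickSeq w ∈ liftSeq k (nablaGraph k) := by
  refine Submodule.span_le.2 ?_ (wickSeq_mem_span w)
  rintro _ ⟨v, rfl⟩
  rw [monomialSeq_eq]
  exact ⟨memLp_nablaFun k v, Submodule.subset_span ⟨v, rfl⟩⟩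

/-- Reduction to Wick words, used both for the semigroup and for the adjoint identity. -/
theorem nablaGraph_le_of_wickSeq {k : ℕ} {G : Submodule ℂ (WignerL2 × MField k (k + 1))}
    (hG : ∀ w, wickSeq w ∈ liftSeq k G) : nablaGraph k ≤ G := by
  refine Submodule.span_le.2 ?_
  rintro _ ⟨v, rfl⟩
  have h1 : monomialSeq v ∈ liftSeq k G := by
    refine Submodule.span_le.2 ?_ (monomialSeq_mem_span v)
    rintro _ ⟨w, rfl⟩
    exact hG w
  rw [monomialSeq_eq] at h1
  obtain ⟨_, h2⟩ := h1
  exact h2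

/-- Cyclicity of the vacuum transferred to Wick words; it later makes the values of the test fields
total. -/
theorem span_wickSeq_fst_dense :
    (Submodule.span ℂ (Set.range fun w => (wickSeq w).1)).topologicalClosure = ⊤ := by
  refine eq_top_iff.2 (scAlg_topologicalClosure.ge.trans ?_)
  refine Submodule.topologicalClosure_mono (Submodule.span_le.2 ?_)
  rintro _ ⟨v, rfl⟩
  have h1 : Submodule.span ℂ (Set.range wickSeq) ≤
      (Submodule.span ℂ (Set.range fun w => (wickSeq w).1)).comap (LinearMap.fst ℂ _ _) := by
    refine Submodule.span_le.2 ?_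
    rintro _ ⟨w, rfl⟩
    exact Submodule.subset_span ⟨w, rfl⟩
  have h2 := h1 (monomialSeq_mem_span v)
  rw [monomialSeq_eq] at h2
  exact h2

/-! ### Commutation with the Ornstein-Uhlenbeck semigroup -/

theorem ouP_vacuum (t : ℝ≥0) : ouP t (vacuum HComplex) = vacuum HComplex :=
  secondQuantization_vacuum _ _

theorem ouP_creation (t : ℝ≥0) (x : HComplex) (u : WignerL2) :
    ouP t (creation x u) = ((Real.exp (-t) : ℝ) : ℂ) • creation x (ouP t u) := by
  rw [ouP, secondQuantization_creation, ← creation_smul]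
  rfl

/-- The semigroup acting on a vector and its iterated derivatives. -/
def ouSeq (t : ℝ≥0) (φ : FieldSeq) : FieldSeq :=
  (ouP t φ.1, fun k s => ((Real.exp (-t) : ℝ) : ℂ) ^ k • HPow.map (ouP t) (k + 1) (φ.2 k s))

/-- The factor `e^{-t}` has two sources: second quantization for the creation part, and the step
from `e^{-kt}` to `e^{-(k+1)t}` for the inserted part. Their agreement is what fixes the constant
`e^{-kt}`. -/
theorem ouSeq_createOp (t : ℝ≥0) (h : HReal) (φ : FieldSeq) :
    ouSeq t (createOp h φ) = ((Real.exp (-t) : ℝ) : ℂ) • createOp h (ouSeq t φ) := by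
  have h1 := fun u => ouP_creation t (complexify h) u
  unfold ouSeq
  generalize ((Real.exp (-t) : ℝ) : ℂ) = c at h1 ⊢
  ext1
  · simp [createOp, headOp, insertOp, h1]
  · funext k s
    cases k with
    | zero => simp [createOp, headOp, insertOp, HPow.map_headMap h1]
    | succ k =>
      simp only [createOp, headOp, insertOp, insertField, LinearMap.add_apply, LinearMap.coe_mk,
        AddHom.coe_mk, Prod.snd_add, Pi.add_apply, map_add, map_smul, HPow.map_headMap h1,
        HPow.map_cons, ouP_vacuum, HPow.cons_smul_right, smul_add, Prod.smul_snd, Pi.smul_apply,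
        smul_smul]
      congr 2 <;> ring

theorem ouSeq_wickSeq (t : ℝ≥0) (w : List HReal) :
    ouSeq t (wickSeq w) = ((Real.exp (-t) : ℝ) : ℂ) ^ w.length • wickSeq w := by
  induction w with
  | nil =>
    ext1
    · simp [ouSeq, wickSeq_nil, vacuumSeq, ouP_vacuum]
    · funext k s
      cases k with
      | zero =>
        have h0 : HPow.map (ouP t) 0 ((HPow.zeroEquiv WignerL2).symm 1) =
          (HPow.zeroEquiv WignerL2).symm 1 := rfl
        simp [ouSeq, wickSeq_nil, vacuumSeq, HPow.map_cons, ouP_vacuum, h0]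
      | succ k => simp [ouSeq, wickSeq_nil, vacuumSeq]
  | cons h w ih =>
    rw [wickSeq_cons, ouSeq_createOp, ih, map_smul, smul_smul, List.length_cons, pow_succ']

/-- The pair `(P_t, e^{-kt} P_t^{⊗(k+1)})`. -/
def ouPair (t : ℝ≥0) (k : ℕ) :
    WignerL2 × MField k (k + 1) →L[ℂ] WignerL2 × MField k (k + 1) :=
  (ouP t).prodMap (((Real.exp (-t) : ℝ) : ℂ) ^ k • ouPField t k (k + 1))

/-- Each Wick word gives an eigenvector of `ouPair`, and a multiple of a point of the graph stays in
the graph. -/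
theorem nablaGraph_le_comap_ouPair (t : ℝ≥0) (k : ℕ) :
    nablaGraph k ≤ (nablaGraph k).comap (ouPair t k).toLinearMap := by
  refine nablaGraph_le_of_wickSeq fun w => ?_
  obtain ⟨h, hG⟩ := wickSeq_mem_liftSeq_nablaGraph k w
  refine ⟨h, ?_⟩
  have h1 := ouSeq_wickSeq t w
  have h2 : ouPair t k ((wickSeq w).1, h.toLp) =
      ((Real.exp (-t) : ℝ) : ℂ) ^ w.length • ((wickSeq w).1, h.toLp) := by
    have h3 : (ouSeq t (wickSeq w)).1 = ((Real.exp (-t) : ℝ) : ℂ) ^ w.length • (wickSeq w).1 :=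
      congrArg Prod.fst h1
    refine Prod.ext h3 (Lp.ext ?_)
    change ⇑(((Real.exp (-t) : ℝ) : ℂ) ^ k • (HPow.map (ouP t) (k + 1)).compLp h.toLp) =ᵐ[_]
      ⇑(((Real.exp (-t) : ℝ) : ℂ) ^ w.length • h.toLp)
    filter_upwards [Lp.coeFn_smul (((Real.exp (-t) : ℝ) : ℂ) ^ k)
        ((HPow.map (ouP t) (k + 1)).compLp h.toLp),
      Lp.coeFn_smul (((Real.exp (-t) : ℝ) : ℂ) ^ w.length) h.toLp,
      (HPow.map (ouP t) (k + 1)).coeFn_compLp h.toLp, h.coeFn_toLp] with s e1 e2 e3 e4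
    rw [e1, e2, Pi.smul_apply, Pi.smul_apply, e3, e4]
    exact congrFun (congrFun (congrArg Prod.snd h1) k) s
  change ouPair t k ((wickSeq w).1, h.toLp) ∈ nablaGraph k
  rw [h2]
  exact Submodule.smul_mem _ _ hG

theorem ouPair_mem_closure (t : ℝ≥0) (k : ℕ) {p : WignerL2 × MField k (k + 1)}
    (hp : p ∈ (nablaGraph k).topologicalClosure) :
    ouPair t k p ∈ (nablaGraph k).topologicalClosure := by
  have h1 : nablaGraph k ≤
      (nablaGraph k).topologicalClosure.comap (ouPair t k).toLinearMap :=
    (nablaGraph_le_comap_ouPair t k).trans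
      (Submodule.comap_mono (nablaGraph k).le_topologicalClosure)
  exact Submodule.topologicalClosure_minimal _ h1
    ((nablaGraph k).isClosed_topologicalClosure.preimage (ouPair t k).continuous) hp

/-! ### Closability -/

/-- `IsTestField k V d`: the field `V` is an elementary tensor and `d` is the image of `V` under the
adjoint of the `k`-th derivative. -/
inductive IsTestField : (k : ℕ) → ((Fin k → ℝ) → WignerL2Pow (k + 1)) → WignerL2 → Prop
  | base (v : WignerL2) :
      IsTestField 0 (fun _ => HPow.cons v ((HPow.zeroEquiv WignerL2).symm 1)) v
  | insert (h : HReal) {k : ℕ} {V : (Fin k → ℝ) → WignerL2Pow (k + 1)} {d : WignerL2}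
      (hV : IsTestField k V d) :
      IsTestField (k + 1) (insertField h V) (creation (complexify h) d)
  | create (h : HReal) {k : ℕ} {V : (Fin (k + 1) → ℝ) → WignerL2Pow (k + 2)} {d : WignerL2}
      (hV : IsTestField (k + 1) V d) :
      IsTestField (k + 1) (fun t => HPow.headMap (creation (complexify h)) (k + 1) (V t))
        (creation (complexify h) d)

theorem IsTestField.memLp {k : ℕ} {V : (Fin k → ℝ) → WignerL2Pow (k + 1)} {d : WignerL2}
    (hV : IsTestField k V d) : MemLp V 2 (Measure.pi fun _ : Fin k => halfLine) := by
  induction hV with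
  | base v =>
    have : IsFiniteMeasure (Measure.pi fun _ : Fin 0 => halfLine) := by
      rw [Measure.pi_of_empty]; infer_instance
    exact memLp_const _
  | insert h _ ih => exact memLp_smul_cons h _ ih
  | create h _ ih => exact (HPow.headMap (creation (complexify h)) _).comp_memLp' ih

/-! ### The adjoint of the iterated derivative -/

theorem inner_complexify (a b : HReal) :
    inner ℂ (complexify a) (complexify b) = ∫ s, ((a s : ℝ) : ℂ) * ((b s : ℝ) : ℂ) ∂halfLine := by
  rw [L2.inner_def]
  refine integral_congr_ae ?_
  filter_upwards [Complex.ofRealCLM.coeFn_compLp a, Complex.ofRealCLM.coeFn_compLp b] with s h1 h2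
  unfold complexify
  rw [h1, h2]
  simp [mul_comm]

theorem integral_inner_insertField (a b : HReal) {k : ℕ}
    (V W : (Fin k → ℝ) → WignerL2Pow (k + 1)) :
    ∫ t, inner ℂ (insertField a V t) (insertField b W t) ∂(Measure.pi fun _ => halfLine) =
      inner ℂ (complexify a) (complexify b) *
        ∫ t, inner ℂ (V t) (W t) ∂(Measure.pi fun _ => halfLine) := by
  rw [inner_complexify, ← integral_prod_mul,
    ← (measurePreserving_piFinSuccAbove (fun _ : Fin (k + 1) => halfLine) 0).integral_comp
      (MeasurableEquiv.measurableEmbedding _)]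
  refine integral_congr_ae (Filter.Eventually.of_forall fun t => ?_)
  simp only [insertField, inner_smul_left, inner_smul_right, HPow.inner_cons, inner_vacuum_vacuum,
    Complex.conj_ofReal, one_mul]
  rw [← mul_assoc, mul_comm ((b (t 0) : ℝ) : ℂ)]
  rfl

/-- In the first leg, `Ω` is orthogonal to the range of every creation operator. -/
theorem inner_insertField_headMap (a : HReal) (x : HComplex) {k : ℕ}
    (V : (Fin k → ℝ) → WignerL2Pow (k + 1)) (t : Fin (k + 1) → ℝ) (z : WignerL2Pow (k + 2)) :
    inner ℂ (insertField a V t) (HPow.headMap (creation x) (k + 1) z) = 0 := by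
  rw [← inner_conj_symm, HPow.inner_headMap_left, insertField, map_smul, HPow.headMap_cons,
    adjoint_creation_vacuum, HPow.cons_zero_left, smul_zero, inner_zero_right, map_zero]

theorem annihilateOp_wickSeq_fst (h : HReal) (w : List HReal) :
    (annihilateOp h (wickSeq w)).1 =
      ContinuousLinearMap.adjoint (creation (complexify h)) (wickSeq w).1 := rfl

theorem annihilateOp_wickSeq_snd (h : HReal) (w : List HReal) (k : ℕ) (t : Fin k → ℝ) :
    (annihilateOp h (wickSeq w)).2 k t =
      HPow.headMap (ContinuousLinearMap.adjoint (creation (complexify h))) k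
        ((wickSeq w).2 k t) := rfl

theorem wickSeq_snd_zero (w : List HReal) (t : Fin 0 → ℝ) :
    (wickSeq w).2 0 t = HPow.cons (wickSeq w).1 ((HPow.zeroEquiv WignerL2).symm 1) := by
  induction w with
  | nil => rfl
  | cons h w ih =>
    have h1 : (wickSeq (h :: w)).2 0 t =
      HPow.headMap (creation (complexify h)) 0 ((wickSeq w).2 0 t) + 0 := rfl
    rw [h1, ih, HPow.headMap_cons, add_zero, wickSeq_cons_fst]

/-- The adjoint of the `k`-th derivative on elementary tensors. -/
theorem IsTestField.integral_inner_wickSeq {k : ℕ} {V : (Fin k → ℝ) → WignerL2Pow (k + 1)}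
    {d : WignerL2} (hV : IsTestField k V d) (w : List HReal) :
    ∫ t, inner ℂ (V t) ((wickSeq w).2 k t) ∂(Measure.pi fun _ => halfLine) =
      inner ℂ d (wickSeq w).1 := by
  induction hV generalizing w with
  | base v =>
    simp_rw [wickSeq_snd_zero, HPow.inner_cons]
    rw [Measure.pi_of_empty]
    simp
  | insert h hV ih =>
    cases w with
    | nil =>
      rw [wickSeq_nil]
      simp [vacuumSeq, inner_creation_vacuum]
    | cons e w =>
      -- Only the term differentiating the leading letter `e` meets the inserted `Ω`; both sides
      -- then carry the factor `⟨h, e⟩` and the order drops by one.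
      simp_rw [wickSeq_cons_snd_succ, inner_add_right, inner_insertField_headMap, zero_add]
      rw [integral_inner_insertField, ih, wickSeq_cons_fst, inner_creation_creation]
  | @create h k V d hV ih =>
    -- Move `l(h)` across both inner products: on the Wick word it becomes an annihilation, which
    -- strips the first letter.
    simp_rw [HPow.inner_headMap_left, ← annihilateOp_wickSeq_snd]
    rw [← ContinuousLinearMap.adjoint_inner_right, ← annihilateOp_wickSeq_fst]
    cases w with
    | nil => simp [wickSeq_nil, annihilateOp_vacuumSeq]
    | cons e w =>
      rw [wickSeq_cons, annihilateOp_createOp]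
      simp only [Prod.smul_fst, Prod.smul_snd, Pi.smul_apply, inner_smul_right]
      rw [integral_const_mul, ih]

/-- For a fixed test field the adjoint identity is a closed linear condition on the pair, so it
passes from Wick words to the closed graph. -/
theorem IsTestField.inner_of_mem_closure {k : ℕ} {V : (Fin k → ℝ) → WignerL2Pow (k + 1)}
    {d : WignerL2} (hV : IsTestField k V d) {p : WignerL2 × MField k (k + 1)}
    (hp : p ∈ (nablaGraph k).topologicalClosure) :
    inner ℂ (hV.memLp.toLp : MField k (k + 1)) p.2 = (inner ℂ d p.1 : ℂ) := by
  set f : WignerL2 × MField k (k + 1) →L[ℂ] ℂ :=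
    innerSL ℂ (hV.memLp.toLp : MField k (k + 1)) ∘L ContinuousLinearMap.snd ℂ _ _ -
      innerSL ℂ d ∘L ContinuousLinearMap.fst ℂ _ _ with hf
  have h1 : nablaGraph k ≤ f.ker := by
    refine nablaGraph_le_of_wickSeq fun w => ?_
    obtain ⟨h, -⟩ := wickSeq_mem_liftSeq_nablaGraph k w
    refine ⟨h, ?_⟩
    have h2 : inner ℂ (hV.memLp.toLp : MField k (k + 1)) h.toLp =
        (inner ℂ d (wickSeq w).1 : ℂ) := by
      rw [← hV.integral_inner_wickSeq w, L2.inner_def]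
      refine integral_congr_ae ?_
      filter_upwards [hV.memLp.coeFn_toLp, h.coeFn_toLp] with t e1 e2
      rw [e1, e2]
    simp [hf, h2]
  have h2 : f p = 0 := Submodule.topologicalClosure_minimal _ h1 f.isClosed_ker hp
  exact sub_eq_zero.1 h2

/-! ### Totality of the test fields -/

/-- Real square integrable function equal to the indicator of a set. -/
def indicatorReal {s : Set ℝ} (hs : MeasurableSet s) (h : halfLine s ≠ ∞) : HReal :=
  indicatorConstLp 2 hs h 1

/-- `v` is the value on the box `s` of a test field vanishing outside of the box. -/
def IsBoxTensor (k : ℕ) (s : Fin k → Set ℝ) (v : WignerL2Pow (k + 1)) : Prop :=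
  ∃ V d, IsTestField k V d ∧
    V =ᵐ[Measure.pi fun _ => halfLine] (Set.univ.pi s).indicator fun _ => v

/-- Inserting the indicator of `s 0` adds a coordinate to the box and an `Ω` leg to the value; the
creators of `w` then turn this `Ω` into the Wick word. -/
theorem isBoxTensor_cons {k : ℕ} {s : Fin (k + 1) → Set ℝ} (hs : MeasurableSet (s 0))
    (h0 : halfLine (s 0) ≠ ∞) {v : WignerL2Pow (k + 1)} (hv : IsBoxTensor k (Fin.tail s) v)
    (w : List HReal) : IsBoxTensor (k + 1) s (HPow.cons (wickSeq w).1 v) := by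
  induction w with
  | nil =>
    obtain ⟨V, d, hV, h⟩ := hv
    refine ⟨_, _, hV.insert (indicatorReal hs h0), ?_⟩
    have hmp := measurePreserving_head_tail k
    -- Almost-everywhere equalities in `t 0` and in the tail are pulled back to the product along
    -- the two projections.
    have h1 : ∀ᵐ t ∂(Measure.pi fun _ : Fin (k + 1) => halfLine),
        indicatorReal hs h0 (t 0) = (s 0).indicator (fun _ => (1 : ℝ)) (t 0) :=
      (Measure.quasiMeasurePreserving_fst.comp hmp.quasiMeasurePreserving).ae
        (p := fun x => indicatorReal hs h0 x = (s 0).indicator (fun _ => (1 : ℝ)) x)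
        indicatorConstLp_coeFn
    have h2 : ∀ᵐ t ∂(Measure.pi fun _ : Fin (k + 1) => halfLine),
        V (Fin.tail t) = (Set.univ.pi (Fin.tail s)).indicator (fun _ => v) (Fin.tail t) :=
      (Measure.quasiMeasurePreserving_snd.comp hmp.quasiMeasurePreserving).ae
        (p := fun x => V x = (Set.univ.pi (Fin.tail s)).indicator (fun _ => v) x) h
    filter_upwards [h1, h2] with t e1 e2
    have h3 : t ∈ Set.univ.pi s ↔ t 0 ∈ s 0 ∧ Fin.tail t ∈ Set.univ.pi (Fin.tail s) := by
      simp [Set.mem_pi, Fin.forall_fin_succ, Fin.tail]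
    rw [insertField, e1, e2]
    by_cases c0 : t 0 ∈ s 0
    · by_cases c1 : Fin.tail t ∈ Set.univ.pi (Fin.tail s)
      · rw [Set.indicator_of_mem c0, Set.indicator_of_mem c1, Set.indicator_of_mem (h3.2 ⟨c0, c1⟩)]
        simp [wickSeq_nil, vacuumSeq]
      · rw [Set.indicator_of_notMem c1, Set.indicator_of_notMem fun c => c1 (h3.1 c).2]
        simp [← HPow.consL_apply]
    · rw [Set.indicator_of_notMem c0, Set.indicator_of_notMem fun c => c0 (h3.1 c).1]
      simp
  | cons e w ih =>
    obtain ⟨V, d, hV, h⟩ := ih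
    refine ⟨_, _, hV.create e, ?_⟩
    filter_upwards [h] with t ht
    rw [ht, wickSeq_cons_fst]
    by_cases c : t ∈ Set.univ.pi s
    · rw [Set.indicator_of_mem c, Set.indicator_of_mem c, HPow.headMap_cons]
    · rw [Set.indicator_of_notMem c, Set.indicator_of_notMem c, map_zero]

/-- One leg at a time: Wick words are dense in the first leg, so it can be any `x`; contracting `z`
against `x` leaves the same problem for the tail of the box. -/
theorem eq_zero_of_inner_isBoxTensor {k : ℕ} {s : Fin k → Set ℝ} (hs : ∀ i, MeasurableSet (s i))
    (hf : ∀ i, halfLine (s i) ≠ ∞) {z : WignerL2Pow (k + 1)}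
    (hz : ∀ v, IsBoxTensor k s v → inner ℂ v z = (0 : ℂ)) : z = 0 := by
  induction k with
  | zero =>
    refine HPow.eq_zero_of_inner_cons fun x u => ?_
    -- The remaining factor is `ℂ`, so the scalar `u` is absorbed into `x`.
    have h1 : HPow.cons x u = HPow.cons (HPow.zeroEquiv WignerL2 u • x)
        ((HPow.zeroEquiv WignerL2).symm 1) := by
      rw [HPow.cons_smul_left, ← HPow.cons_smul_right, ← map_smul]
      simp
    rw [h1]
    refine hz _ ⟨_, _, IsTestField.base (HPow.zeroEquiv WignerL2 u • x),
      Filter.Eventually.of_forall fun t => ?_⟩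
    have ht : t ∈ Set.univ.pi s := fun i => i.elim0
    rw [Set.indicator_of_mem ht]
  | succ k ih =>
    have h1 : ∀ v, IsBoxTensor k (Fin.tail s) v → ∀ x, inner ℂ (HPow.cons x v) z = (0 : ℂ) := by
      intro v hv x
      have h2 : Submodule.span ℂ (Set.range fun w => (wickSeq w).1) ≤
          (innerSL ℂ z ∘L HPow.consR v).ker := by
        refine Submodule.span_le.2 ?_
        rintro _ ⟨w, rfl⟩
        simpa using inner_eq_zero_symm.1 (hz _ (isBoxTensor_cons (hs 0) (hf 0) hv w))
      have h3 : x ∈ (innerSL ℂ z ∘L HPow.consR v).ker :=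
        Submodule.topologicalClosure_minimal _ h2 (ContinuousLinearMap.isClosed_ker _)
          (span_wickSeq_fst_dense ▸ Submodule.mem_top)
      exact inner_eq_zero_symm.1 (by simpa using h3)
    refine HPow.eq_zero_of_inner_cons fun x u => ?_
    have h4 : ContinuousLinearMap.adjoint (HPow.consL x) z = 0 :=
      ih (s := Fin.tail s) (fun i => hs i.succ) (fun i => hf i.succ) fun v hv => by
        rw [ContinuousLinearMap.adjoint_inner_right]
        exact h1 v hv x
    rw [← HPow.consL_apply, ← ContinuousLinearMap.adjoint_inner_right, h4, inner_zero_right]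

/-- A square integrable function on a product is zero if its integrals over finite boxes vanish. -/
theorem eq_zero_of_setIntegral_box {ι F : Type*} [Fintype ι] [NormedAddCommGroup F]
    [NormedSpace ℝ F] [CompleteSpace F] {μ : Measure ℝ} [SigmaFinite μ]
    {ν : Measure (ι → ℝ)} (hν : ν = Measure.pi fun _ => μ) (y : Lp F 2 ν)
    (hy : ∀ s : ι → Set ℝ, (∀ i, MeasurableSet (s i)) → (∀ i, μ (s i) ≠ ∞) →
      ∫ t in Set.univ.pi s, y t ∂ν = 0) : y = 0 := by
  -- On a box of finite measure `L²` is contained in `L¹`, so a π-λ argument over sub-boxes applies;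
  -- such boxes exhaust the space.
  have hbox : ∀ n : ℕ, ∀ᵐ t ∂ν, t ∈ Set.univ.pi (fun _ : ι => spanningSets μ n) → y t = 0 := by
    intro n
    set R : Set (ι → ℝ) := Set.univ.pi fun _ => spanningSets μ n with hR
    have hRm : MeasurableSet R :=
      MeasurableSet.univ_pi fun _ => measurableSet_spanningSets μ n
    have hRf : ν R < ∞ := by
      rw [hν, hR, Measure.pi_pi]
      exact ENNReal.prod_lt_top fun _ _ => measure_spanningSets_lt_top μ n
    have : IsFiniteMeasure (ν.restrict R) := ⟨by simpa using hRf⟩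
    have hint : Integrable y (ν.restrict R) :=
      ((Lp.memLp y).restrict R).integrable (by norm_num)
    have hall : ∀ A, MeasurableSet A → ∫ t in A, y t ∂(ν.restrict R) = 0 := by
      intro A hA
      have hgen := (generateFrom_pi (α := fun _ : ι => ℝ)).symm
      induction A, hA using MeasurableSpace.induction_on_inter hgen isPiSystem_pi with
      | empty => simp
      | basic A hA =>
        obtain ⟨s, hs, rfl⟩ := hA
        have hs' : ∀ i, MeasurableSet (s i) := fun i => hs i (Set.mem_univ i)
        rw [Measure.restrict_restrict (MeasurableSet.univ_pi hs'), hR, ← Set.pi_inter_distrib]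
        exact hy _ (fun i => (hs' i).inter (measurableSet_spanningSets μ n)) fun i =>
          ((measure_mono Set.inter_subset_right).trans_lt (measure_spanningSets_lt_top μ n)).ne
      | compl A hA ih =>
        have h1 := integral_add_compl hA hint
        rw [ih, zero_add] at h1
        rw [h1]
        -- The integral over the whole of `R` vanishes because `R` is itself a box.
        exact hy _ (fun i => measurableSet_spanningSets μ n) fun i =>
          (measure_spanningSets_lt_top μ n).ne
      | iUnion f hd hm ih =>
        rw [integral_iUnion hm hd hint.integrableOn]
        simp [ih]
    rw [← ae_restrict_iff' hRm]
    exact hint.ae_eq_zero_of_forall_setIntegral_eq_zero fun A hA _ => hall A hA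
  rw [Lp.eq_zero_iff_ae_eq_zero]
  filter_upwards [ae_all_iff.2 hbox] with t ht
  obtain ⟨n, hn⟩ : ∃ n, ∀ i, t i ∈ spanningSets μ n := by
    have h1 : ∀ i, ∃ n, t i ∈ spanningSets μ n := fun i => by
      simp [← Set.mem_iUnion, iUnion_spanningSets]
    choose N hN using h1
    -- The coordinates enter the exhausting sets at different indices; the largest one serves for
    -- all.
    exact ⟨Finset.univ.sup N, fun i =>
      monotone_spanningSets μ (Finset.le_sup (Finset.mem_univ i)) (hN i)⟩
  exact ht n fun i _ => hn i

/-- The iterated derivative is well defined and closable. -/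
theorem snd_eq_zero_of_mem_closure {k : ℕ} {p : WignerL2 × MField k (k + 1)}
    (hp : p ∈ (nablaGraph k).topologicalClosure) (h0 : p.1 = 0) : p.2 = 0 := by
  refine eq_zero_of_setIntegral_box rfl p.2 fun s hs hf => ?_
  set ν := Measure.pi fun _ : Fin k => halfLine with hν
  have hRf : ν (Set.univ.pi s) < ∞ := by
    rw [hν, Measure.pi_pi]
    exact ENNReal.prod_lt_top fun i _ => (hf i).lt_top
  have : IsFiniteMeasure (ν.restrict (Set.univ.pi s)) := ⟨by simpa using hRf⟩
  have hint : Integrable p.2 (ν.restrict (Set.univ.pi s)) :=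
    ((Lp.memLp p.2).restrict _).integrable (by norm_num)
  -- The box integral paired with `v` equals the pairing of `p.2` with a test field, that is `⟨d,
  -- p.1⟩ = 0`.
  refine eq_zero_of_inner_isBoxTensor hs hf ?_
  rintro v ⟨V, d, hV, h⟩
  have h1 := hV.inner_of_mem_closure hp
  rw [h0, inner_zero_right, L2.inner_def] at h1
  rw [← integral_inner hint, ← integral_indicator (MeasurableSet.univ_pi hs), ← h1]
  refine integral_congr_ae ?_
  filter_upwards [h, hV.memLp.coeFn_toLp] with t e1 e2
  rw [e2, e1]
  by_cases c : t ∈ Set.univ.pi s <;> simp [c]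

theorem nabla_graph (k : ℕ) : (nabla k).graph = (nablaGraph k).topologicalClosure :=
  Submodule.toLinearPMap_graph_eq _ fun _ hp h0 => snd_eq_zero_of_mem_closure hp h0

end FreeWigner

end

/-- The first conjunct expresses well-definedness and closability: a graph is single-valued, so the
equality forces the closed span to be the graph of an operator. -/
theorem mainTheorem11 (k : ℕ) (hk : 1 ≤ k) :
    (FreeWigner.nabla k).graph = (FreeWigner.nablaGraph k).topologicalClosure ∧
    ∀ (F : FreeWigner.WignerL2) (hF : F ∈ (FreeWigner.nabla k).domain) (t : NNReal), 0 < t →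
      ∃ hP : FreeWigner.ouP t F ∈ (FreeWigner.nabla k).domain,
        FreeWigner.nabla k ⟨FreeWigner.ouP t F, hP⟩ =
          ((Real.exp (-((k : ℝ) * (t : ℝ))) : ℝ) : ℂ) •
            FreeWigner.ouPField t k (k + 1) (FreeWigner.nabla k ⟨F, hF⟩) := by
  refine ⟨FreeWigner.nabla_graph k, fun F hF t _ => ?_⟩
  have h1 : (F, FreeWigner.nabla k ⟨F, hF⟩) ∈ (FreeWigner.nabla k).graph :=
    (FreeWigner.nabla k).mem_graph ⟨F, hF⟩
  rw [FreeWigner.nabla_graph] at h1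
  have h2 := FreeWigner.ouPair_mem_closure t k h1
  -- Membership of the transformed pair in the graph gives both the domain statement and the value.
  rw [← FreeWigner.nabla_graph, LinearPMap.mem_graph_iff] at h2
  obtain ⟨⟨u, hu⟩, h3, h4⟩ := h2
  obtain rfl : u = FreeWigner.ouP t F := h3
  refine ⟨hu, h4.trans ?_⟩
  have h5 : Real.exp (-((k : ℝ) * (t : ℝ))) = Real.exp (-t) ^ k := by
    rw [← Real.exp_nat_mul]
    ring_nf
  rw [h5, Complex.ofReal_pow]
  rfl
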